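/- **Dyadic decomposition.** Let $\mathbb H=\{z\in\mathbb C:\operatorname{Im} z>0\}$ and let $\lambda:[0,\infty)\to\mathbb R$ be continuous. For $t\ge 0$ let $H_t$ be the set of $w\in\mathbb H$ for which the Loewner equation $$\partial_s g_s(w)=\frac{2}{g_s(w)-\lambda(s)},\qquad g_0(w)=w,$$ has a solution in $\mathbb H$ for all $s\in[0,t]$, so that $g_t:H_t\to\mathbb H$ is a conformal bijection. Let $f_t=g_t^{-1}:\mathbb H\to H_t$ be the inverse Loewner flow driven by $\lambda$ and put $\hat f_t(z)=f_t(\lambda(t)+z)$, $z\in\mathbb H$; here $\hat f_t'$ denotes the complex derivative in $z$. For $y>0$ and $t\ge0$ let $$p(t,y)=\frac1y\sup_{s\in[0,y^2]}|\lambda(t+s)-\lambda(t)|.$$ There are universal constants $c_1,c_2>0$ (not depending on $\lambda$, $\beta$ or $n$) such that, with $Q(x)=c_1(1+x^2)^{c_2}$, the following holds for every such $\lambda$, every $\beta\in(0,1)$ and every integer $n\ge0$. If $$|\hat f'_{j/2^{2m}}(i2^{-m})|\le 2^{\beta m}\qquad\text{for all integers } m\ge n \text{ and } 1\le j\le 2^{2m},$$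 then for all $t\in[0,1]$ and $y\in(0,2^{-n}]$ the map $\hat f_t$ is complex differentiable at $iy$ and $$|\hat f'_t(iy)|\le Q(p(t,y))\,y^{-\beta}.$$ -/

import Mathlib

namespace Loewner

/-- `u` solves the chordal Loewner equation `u'(s) = 2 / (u(s) - lam(s))`, `u(0) = w`, in the open
upper half-plane on the whole time interval `[0, t]`. -/
def IsTrajectory (lam : ℝ → ℝ) (t : ℝ) (w : ℂ) (u : ℝ → ℂ) : Prop :=
  u 0 = w ∧ ∀ s ∈ Set.Icc (0 : ℝ) t,
    0 < (u s).im ∧ HasDerivWithinAt u (2 / (u s - (lam s : ℂ))) (Set.Icc 0 t) s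

/-- The domain of `g_t`: the points of the upper half-plane from which the Loewner equation can be
solved in the upper half-plane up to time `t`, i.e. the complement in the upper half-plane of the
hull at time `t`. -/
def domain (lam : ℝ → ℝ) (t : ℝ) : Set ℂ :=
  {w | 0 < w.im ∧ ∃ u : ℝ → ℂ, IsTrajectory lam t w u}

/-- The forward Loewner map `g_t`: the value at time `t` of the solution started from `w`
(the solution is unique on `[0, t]`; the value is arbitrary for `w` outside `domain lam t`). -/
noncomputable def g (lam : ℝ → ℝ) (t : ℝ) (w : ℂ) : ℂ :=
  Classical.epsilon (IsTrajectory lam t w) t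

/-- The inverse Loewner flow `f_t = g_t⁻¹`, which maps the upper half-plane onto `domain lam t`. -/
noncomputable def f (lam : ℝ → ℝ) (t : ℝ) : ℂ → ℂ :=
  Function.invFunOn (g lam t) (domain lam t)

/-- The centered inverse map `z ↦ f_t(lam(t) + z)`. -/
noncomputable def fHat (lam : ℝ → ℝ) (t : ℝ) (z : ℂ) : ℂ :=
  f lam t ((lam t : ℂ) + z)

/-- `p(t, y) = (1 / y) sup_{s ∈ [0, y²]} |lam(t + s) - lam(t)|`. -/
noncomputable def p (lam : ℝ → ℝ) (t y : ℝ) : ℝ :=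
  (1 / y) * sSup ((fun s : ℝ => |lam (t + s) - lam t|) '' Set.Icc 0 (y ^ 2))

/-- `Q(x) = c₁ (1 + x²) ^ c₂`. -/
noncomputable def Q (c₁ c₂ x : ℝ) : ℝ :=
  c₁ * (1 + x ^ 2) ^ c₂

end Loewner

namespace Loewner

open Set Filter Topology

/-! Let `u` be a trajectory with `u t = z`. Then `f_t(z) = u 0` and `f_t'(z) = exp ∫₀ᵗ 2/(u - λ)²`,
so statements about `f_t'` become statements about trajectories.

Given `(t, y)`, take `m` with `2^{-m} ≤ y ≤ 2·2^{-m}`, put `η = 2^{-m}`, and take a dyadic time `s =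
j/2^{2m} ≥ t` with `s - t ≤ η²`. The trajectory that ends at `λ(s) + iη` at time `s` has speed at
most `2/η`. So between `t` and `s` it moves by at most `2η`, and the derivative changes by at most a
factor `e²` (`norm_exp_integral_restrict_le`). At time `t`, its hyperbolic distance to `λ(t) + iy`
is controlled by `p(t, y)`, and a distortion estimate for `f_t'` finishes the comparison
(`norm_deriv_fHat_le`).

The distortion estimate (`norm_exp_integral_le`) comes from the flow instead of Koebe's theorem. One
has `|f_t'| = (Im u 0 / Im u t) exp(-4∫P²)` with `P` the Poisson kernel. The hyperbolic distance of
two trajectories increases in time, fast enough to dominate the difference of their integrals `∫P²`.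
-/

/-! ### Trajectories: linear equation for differences, uniqueness, injectivity -/

lemma hasDerivWithinAt_integral_Icc {E : Type*} [NormedAddCommGroup E] [NormedSpace ℝ E]
    [CompleteSpace E] {t : ℝ} {c : ℝ → E} (hc : ContinuousOn c (Icc 0 t)) {s : ℝ}
    (hs : s ∈ Icc 0 t) :
    HasDerivWithinAt (fun r => ∫ x in (0 : ℝ)..r, c x) (c s) (Icc 0 t) s := by
  have : Fact (s ∈ Icc 0 t) := ⟨hs⟩
  refine intervalIntegral.integral_hasDerivWithinAt_right ?_ ?_ (hc s hs)
  · refine (hc.mono ?_).intervalIntegrable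
    rw [uIcc_of_le hs.1]
    exact Icc_subset_Icc_right hs.2
  · exact hc.stronglyMeasurableAtFilter_nhdsWithin measurableSet_Icc s

lemma eqOn_exp_of_linear_ode {t : ℝ} {c v : ℝ → ℂ} (hc : ContinuousOn c (Icc 0 t))
    (hv : ∀ s ∈ Icc 0 t, HasDerivWithinAt v (c s * v s) (Icc 0 t) s) {s : ℝ} (hs : s ∈ Icc 0 t) :
    v s = v 0 * Complex.exp (∫ x in (0 : ℝ)..s, c x) := by
  have hder : ∀ r ∈ Icc 0 t,
      HasDerivWithinAt (fun r => v r * Complex.exp (-∫ x in (0 : ℝ)..r, c x)) 0 (Icc 0 t) r := by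
    intro r hr
    have h1 := (hv r hr).mul (hasDerivWithinAt_integral_Icc hc hr).neg.cexp
    refine h1.congr_deriv ?_
    simp only [Pi.neg_apply]
    ring
  have hconst := constant_of_has_deriv_right_zero
    (fun r hr => (hder r hr).continuousWithinAt)
    (fun r hr => (hder r ⟨hr.1, hr.2.le⟩).mono_of_mem_nhdsWithin
      (Icc_mem_nhdsGE_of_mem ⟨hr.1, hr.2⟩)) s hs
  simp only [intervalIntegral.integral_same, neg_zero, Complex.exp_zero, mul_one] at hconst
  rw [← hconst, mul_assoc, ← Complex.exp_add, neg_add_cancel, Complex.exp_zero, mul_one]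

variable {lam : ℝ → ℝ} {t : ℝ} {w w' : ℂ} {u v : ℝ → ℂ}

namespace IsTrajectory

lemma continuousOn (h : IsTrajectory lam t w u) : ContinuousOn u (Icc 0 t) :=
  fun s hs => (h.2 s hs).2.continuousWithinAt

lemma restrict (h : IsTrajectory lam t w u) {s : ℝ} (hs : s ≤ t) : IsTrajectory lam s w u :=
  ⟨h.1, fun r hr => ⟨(h.2 r ⟨hr.1, hr.2.trans hs⟩).1,
    (h.2 r ⟨hr.1, hr.2.trans hs⟩).2.mono (Icc_subset_Icc_right hs)⟩⟩

lemma sub_ne_zero (h : IsTrajectory lam t w u) {s : ℝ} (hs : s ∈ Icc 0 t) :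
    u s - (lam s : ℂ) ≠ 0 := by
  intro h0
  have := (h.2 s hs).1
  have h1 := congrArg Complex.im h0
  simp at h1
  linarith

lemma continuousOn_sub (hl : ContinuousOn lam (Icc 0 t)) (h : IsTrajectory lam t w u) :
    ContinuousOn (fun s => u s - (lam s : ℂ)) (Icc 0 t) :=
  h.continuousOn.sub (Complex.continuous_ofReal.comp_continuousOn hl)

lemma continuousOn_mul (hl : ContinuousOn lam (Icc 0 t)) (h : IsTrajectory lam t w u)
    (h' : IsTrajectory lam t w' v) :
    ContinuousOn (fun s => 2 / ((u s - (lam s : ℂ)) * (v s - lam s))) (Icc 0 t) :=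
  continuousOn_const.div ((h.continuousOn_sub hl).mul (h'.continuousOn_sub hl))
    fun _ hs => mul_ne_zero (h.sub_ne_zero hs) (h'.sub_ne_zero hs)

lemma hasDerivWithinAt_re (h : IsTrajectory lam t w u) {s : ℝ} (hs : s ∈ Icc 0 t) :
    HasDerivWithinAt (fun s => (u s).re)
      (2 * (((u s).re - lam s) / (((u s).re - lam s) ^ 2 + (u s).im ^ 2))) (Icc 0 t) s := by
  have h1 := Complex.reCLM.hasFDerivAt.comp_hasDerivWithinAt s (h.2 s hs).2
  refine h1.congr_deriv ?_
  simp [Complex.div_re, Complex.normSq_apply]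
  ring

lemma hasDerivWithinAt_im (h : IsTrajectory lam t w u) {s : ℝ} (hs : s ∈ Icc 0 t) :
    HasDerivWithinAt (fun s => (u s).im)
      (-2 * ((u s).im / (((u s).re - lam s) ^ 2 + (u s).im ^ 2))) (Icc 0 t) s := by
  have h1 := Complex.imCLM.hasFDerivAt.comp_hasDerivWithinAt s (h.2 s hs).2
  refine h1.congr_deriv ?_
  simp [Complex.div_im, Complex.normSq_apply]
  ring

lemma antitoneOn_im (h : IsTrajectory lam t w u) : AntitoneOn (fun s => (u s).im) (Icc 0 t) := by
  refine antitoneOn_of_hasDerivWithinAt_nonpos (convex_Icc 0 t)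
    (f' := fun s => -2 * ((u s).im / (((u s).re - lam s) ^ 2 + (u s).im ^ 2)))
    (fun s hs => (h.hasDerivWithinAt_im hs).continuousWithinAt)
    (fun s hs => (h.hasDerivWithinAt_im (interior_subset hs)).mono interior_subset) ?_
  intro s hs
  have := (h.2 s (interior_subset hs)).1
  have : 0 ≤ (u s).im / (((u s).re - lam s) ^ 2 + (u s).im ^ 2) := by positivity
  linarith

lemma im_le_norm_sub (h : IsTrajectory lam t w u) {s : ℝ} (hs : s ∈ Icc 0 t) :
    (u t).im ≤ ‖u s - (lam s : ℂ)‖ := by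
  have h1 : (u t).im ≤ (u s).im := h.antitoneOn_im hs ⟨hs.1.trans hs.2, le_rfl⟩ hs.2
  have h2 := Complex.im_le_norm (u s - (lam s : ℂ))
  simp at h2
  linarith

/-- The difference of two trajectories solves a linear equation. -/
lemma sub_eq (hl : ContinuousOn lam (Icc 0 t)) (h : IsTrajectory lam t w u)
    (h' : IsTrajectory lam t w' v) {s : ℝ} (hs : s ∈ Icc 0 t) :
    u s - v s = (w - w') *
      Complex.exp (-∫ x in (0 : ℝ)..s, 2 / ((u x - (lam x : ℂ)) * (v x - lam x))) := by
  have := eqOn_exp_of_linear_ode (v := fun s => u s - v s) (h.continuousOn_mul hl h').neg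
    (fun r hr => ?_) hs
  · simpa [intervalIntegral.integral_neg, h.1, h'.1] using this
  · refine ((h.2 r hr).2.sub (h'.2 r hr).2).congr_deriv ?_
    have h1 := h.sub_ne_zero hr
    have h2 := h'.sub_ne_zero hr
    simp only [Pi.neg_apply]
    field_simp
    ring

lemma eqOn (hl : ContinuousOn lam (Icc 0 t)) (h : IsTrajectory lam t w u)
    (h' : IsTrajectory lam t w v) : EqOn u v (Icc 0 t) := by
  intro s hs
  have := h.sub_eq hl h' hs
  rw [sub_self, zero_mul] at this
  exact _root_.sub_eq_zero.1 this

lemma initial_sub_eq (ht : 0 ≤ t) (hl : ContinuousOn lam (Icc 0 t)) (h : IsTrajectory lam t w u)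
    (h' : IsTrajectory lam t w' v) :
    w - w' = (u t - v t) *
      Complex.exp (∫ x in (0 : ℝ)..t, 2 / ((u x - (lam x : ℂ)) * (v x - lam x))) := by
  rw [h.sub_eq hl h' ⟨ht, le_rfl⟩, mul_assoc, ← Complex.exp_add, neg_add_cancel, Complex.exp_zero,
    mul_one]

lemma g_eq (ht : 0 ≤ t) (hl : ContinuousOn lam (Icc 0 t)) (h : IsTrajectory lam t w u) :
    g lam t w = u t :=
  (Classical.epsilon_spec (⟨u, h⟩ : ∃ u, IsTrajectory lam t w u)).eqOn hl h ⟨ht, le_rfl⟩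

lemma mem_domain (ht : 0 ≤ t) (h : IsTrajectory lam t w u) : w ∈ domain lam t :=
  ⟨h.1 ▸ (h.2 0 ⟨le_rfl, ht⟩).1, u, h⟩

/-- Two trajectories with the same end point start at the same point, so whichever preimage
`invFunOn` picks is `w`. -/
lemma f_eq (ht : 0 ≤ t) (hl : ContinuousOn lam (Icc 0 t)) (h : IsTrajectory lam t w u) :
    f lam t (u t) = w := by
  have hex : ∃ a ∈ domain lam t, g lam t a = u t := ⟨w, h.mem_domain ht, h.g_eq ht hl⟩
  have hmem := Function.invFunOn_mem hex
  have heq := Function.invFunOn_eq hex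
  obtain ⟨-, v, hv⟩ := hmem
  rw [hv.g_eq ht hl] at heq
  have := hv.initial_sub_eq ht hl h
  rw [heq, sub_self, zero_mul] at this
  exact _root_.sub_eq_zero.1 this

end IsTrajectory

/-! ### Existence of trajectories with prescribed end point -/

lemma norm_two_div_sub_two_div_le {y : ℝ} (hy : 0 < y) {a b : ℂ} (ha : y ≤ a.im) (hb : y ≤ b.im) :
    ‖2 / a - 2 / b‖ ≤ 2 / y ^ 2 * ‖a - b‖ := by
  have hna : y ≤ ‖a‖ := ha.trans (Complex.im_le_norm a)
  have hnb : y ≤ ‖b‖ := hb.trans (Complex.im_le_norm b)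
  have ha0 : a ≠ 0 := norm_pos_iff.1 (hy.trans_le hna)
  have hb0 : b ≠ 0 := norm_pos_iff.1 (hy.trans_le hnb)
  have h1 : 2 / a - 2 / b = 2 / (a * b) * (b - a) := by
    field_simp
  rw [h1, norm_mul, norm_div, norm_mul, norm_sub_rev b a, Complex.norm_two, sq]
  gcongr

/-- The map pushing a point vertically into the half-plane `y ≤ im`. -/
def clampIm (y : ℝ) (z : ℂ) : ℂ := ⟨z.re, max z.im y⟩

lemma norm_clampIm_sub_le (y : ℝ) (a b : ℂ) : ‖clampIm y a - clampIm y b‖ ≤ ‖a - b‖ := by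
  rw [Complex.norm_def, Complex.norm_def]
  refine Real.sqrt_le_sqrt ?_
  simp only [Complex.normSq_apply, clampIm, Complex.sub_re, Complex.sub_im]
  linarith [sq_le_sq.2 (abs_max_sub_max_le_abs a.im b.im y), sq (max a.im y - max b.im y),
    sq (a.im - b.im)]


/-- Every point of the upper half-plane is the end point of a trajectory. -/
lemma exists_isTrajectory (ht : 0 ≤ t) (hl : ContinuousOn lam (Icc 0 t)) {z : ℂ} (hz : 0 < z.im) :
    ∃ w u, IsTrajectory lam t w u ∧ u t = z := by
  set y := z.im
  have him : ∀ (s : ℝ) (x : ℂ), y ≤ (clampIm y x - (lam s : ℂ)).im := by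
    intro s x
    simp [clampIm]
  have hne : ∀ (s : ℝ) (x : ℂ), clampIm y x - (lam s : ℂ) ≠ 0 := by
    intro s x h0
    have := him s x
    rw [h0] at this
    exact absurd this (not_le.2 hz)
  -- Clamping makes the field globally bounded by `2/y` and `2/y²`-Lipschitz. The condition is
  -- imposed at the final time `t`, so the equation is solved backwards.
  have hpl : IsPicardLindelof (fun s x => 2 / (clampIm y x - (lam s : ℂ)))
      (⟨t, ht, le_rfl⟩ : Icc (0 : ℝ) t) z (Real.toNNReal (2 / y * t)) 0 (Real.toNNReal (2 / y))
      (Real.toNNReal (2 / y ^ 2)) := by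
    refine ⟨fun s _ => LipschitzOnWith.of_dist_le_mul fun a _ b _ => ?_, fun x _ => ?_,
      fun s _ x _ => ?_, ?_⟩
    · rw [dist_eq_norm, dist_eq_norm, Real.coe_toNNReal _ (by positivity)]
      refine (norm_two_div_sub_two_div_le hz (him s a) (him s b)).trans ?_
      rw [sub_sub_sub_cancel_right]
      gcongr
      exact norm_clampIm_sub_le y a b
    · exact continuousOn_const.div
        (continuousOn_const.sub (Complex.continuous_ofReal.comp_continuousOn hl))
        fun s _ => hne s x
    · rw [Real.coe_toNNReal _ (by positivity), norm_div, Complex.norm_two]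
      gcongr
      exact (him s x).trans (Complex.im_le_norm _)
    · rw [Real.coe_toNNReal _ (by positivity), Real.coe_toNNReal _ (by positivity)]
      simp [ht]
  obtain ⟨u, hut, hu⟩ := hpl.exists_eq_forall_mem_Icc_hasDerivWithinAt₀
  simp only at hut
  have himder : ∀ s ∈ Icc 0 t, HasDerivWithinAt (fun s => (u s).im)
      (2 / (clampIm y (u s) - (lam s : ℂ))).im (Icc 0 t) s := fun s hs =>
    Complex.imCLM.hasFDerivAt.comp_hasDerivWithinAt s (hu s hs)
  have hanti : AntitoneOn (fun s => (u s).im) (Icc 0 t) := by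
    refine antitoneOn_of_hasDerivWithinAt_nonpos (convex_Icc 0 t)
      (f' := fun s => (2 / (clampIm y (u s) - (lam s : ℂ))).im)
      (fun s hs => (himder s hs).continuousWithinAt)
      (fun s hs => (himder s (interior_subset hs)).mono interior_subset) ?_
    intro s _
    have h1 := hz.le.trans (him s (u s))
    rw [Complex.div_im]
    simp only [Complex.im_ofNat, zero_mul, zero_div, Complex.re_ofNat, zero_sub, Left.neg_nonpos_iff]
    have := Complex.normSq_nonneg (clampIm y (u s) - (lam s : ℂ))
    positivity
  -- The imaginary part decreases to its final value `y`, so the clamp is never active.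
  have hge : ∀ s ∈ Icc 0 t, y ≤ (u s).im := by
    intro s hs
    have := hanti hs ⟨ht, le_rfl⟩ hs.2
    simpa [hut] using this
  refine ⟨u 0, u, ⟨rfl, fun s hs => ⟨hz.trans_le (hge s hs), ?_⟩⟩, hut⟩
  have hcl : clampIm y (u s) = u s := by
    apply Complex.ext <;> simp [clampIm, hge s hs]
  simpa [hcl] using hu s hs

/-! ### Complex derivative of the inverse map -/

lemma IsTrajectory.norm_integrand_le
    (h : IsTrajectory lam t w u) (h' : IsTrajectory lam t w' v) {y : ℝ} (hy : 0 < y)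
    (hu : y ≤ (u t).im) (hv : y ≤ (v t).im) {s : ℝ} (hs : s ∈ Icc 0 t) :
    ‖2 / ((u s - (lam s : ℂ)) * (v s - lam s))‖ ≤ 2 / (y * y) := by
  rw [norm_div, norm_mul, Complex.norm_two]
  gcongr
  · exact hu.trans (h.im_le_norm_sub hs)
  · exact hv.trans (h'.im_le_norm_sub hs)

lemma IsTrajectory.norm_sub_le {w w' : ℂ} {u v : ℝ → ℂ} (ht : 0 ≤ t)
    (hl : ContinuousOn lam (Icc 0 t))
    (h : IsTrajectory lam t w u) (h' : IsTrajectory lam t w' v) {y : ℝ} (hy : 0 < y)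
    (hu : y ≤ (u t).im) (hv : y ≤ (v t).im) {s : ℝ} (hs : s ∈ Icc 0 t) :
    ‖u s - v s‖ ≤ ‖u t - v t‖ * Real.exp (2 * (2 / (y * y) * t)) := by
  have hint : ∀ r ∈ Icc 0 t,
      ‖∫ x in (0 : ℝ)..r, 2 / ((u x - (lam x : ℂ)) * (v x - lam x))‖ ≤ 2 / (y * y) * t := by
    intro r hr
    have := intervalIntegral.norm_integral_le_of_norm_le_const (a := 0) (b := r)
      (f := fun x => 2 / ((u x - (lam x : ℂ)) * (v x - lam x))) (C := 2 / (y * y)) (fun x hx => by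
        rw [uIoc_of_le hr.1] at hx
        exact h.norm_integrand_le h' hy hu hv ⟨hx.1.le, hx.2.trans hr.2⟩)
    refine this.trans ?_
    rw [sub_zero, abs_of_nonneg hr.1]
    gcongr
    exact hr.2
  rw [h.sub_eq hl h' hs, h.initial_sub_eq ht hl h', mul_assoc, ← Complex.exp_add, norm_mul,
    Complex.norm_exp]
  gcongr
  -- The bound on the integral is used twice: from `t` back to `0`, then from `0` to `s`.
  refine (Complex.re_le_norm _).trans ((norm_add_le _ _).trans ?_)
  rw [norm_neg]
  linarith [hint s hs, hint t ⟨ht, le_rfl⟩]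

/-- The derivative of the inverse Loewner map at the end point of a trajectory. -/
lemma IsTrajectory.hasDerivAt_f (ht : 0 ≤ t)
    (hl : ContinuousOn lam (Icc 0 t)) (h : IsTrajectory lam t w u) :
    HasDerivAt (f lam t)
      (Complex.exp (∫ s in (0 : ℝ)..t, 2 / ((u s - (lam s : ℂ)) * (u s - lam s)))) (u t) := by
  have hy : 0 < (u t).im / 2 := half_pos (h.2 t ⟨ht, le_rfl⟩).1
  -- Half the height leaves room for nearby end points to satisfy the same lower bound.
  set y := (u t).im / 2 with hydef
  have hyu : y ≤ (u t).im := by linarith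
  choose! W U hU using fun (z : ℂ) (hz : 0 < z.im) => exists_isTrajectory ht hl hz
  have hev : ∀ᶠ z in 𝓝[≠] (u t), y < z.im :=
    nhdsWithin_le_nhds (Complex.continuous_im.continuousAt.eventually (lt_mem_nhds (by linarith)))
  rw [hasDerivAt_iff_tendsto_slope]
  -- The difference quotient is exactly the exponential of a mixed integral, so only a limit under
  -- the integral sign remains.
  have hslope : (fun z => Complex.exp
      (∫ s in (0 : ℝ)..t, 2 / ((U z s - (lam s : ℂ)) * (u s - lam s)))) =ᶠ[𝓝[≠] (u t)]
      slope (f lam t) (u t) := by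
    filter_upwards [hev, self_mem_nhdsWithin] with z hz hne
    obtain ⟨h1, h2⟩ := hU z (hy.trans hz)
    rw [slope_def_field, h.f_eq ht hl]
    have h3 := h1.f_eq ht hl
    have h4 := h1.initial_sub_eq ht hl h
    rw [h2] at h3 h4
    rw [h3, h4, mul_div_cancel_left₀ _ (_root_.sub_ne_zero.2 hne)]
  refine Tendsto.congr' hslope ?_
  refine (Complex.continuous_exp.tendsto _).comp ?_
  refine intervalIntegral.tendsto_integral_filter_of_dominated_convergence
    (fun _ => 2 / (y * y)) ?_ ?_ intervalIntegrable_const ?_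
  · filter_upwards [hev] with z hz
    rw [uIoc_of_le ht]
    exact (((hU z (hy.trans hz)).1.continuousOn_mul hl h).mono
      Ioc_subset_Icc_self).aestronglyMeasurable measurableSet_Ioc
  · filter_upwards [hev] with z hz
    refine Eventually.of_forall fun s hs => ?_
    rw [uIoc_of_le ht] at hs
    obtain ⟨h1, h2⟩ := hU z (hy.trans hz)
    exact h1.norm_integrand_le h hy (by rw [h2]; exact hz.le) hyu (Ioc_subset_Icc_self hs)
  · refine Eventually.of_forall fun s hs => ?_
    rw [uIoc_of_le ht] at hs
    have hs' := Ioc_subset_Icc_self hs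
    have hlim : Tendsto (fun z => U z s) (𝓝[≠] (u t)) (𝓝 (u s)) := by
      rw [tendsto_iff_norm_sub_tendsto_zero]
      have hz0 : Tendsto (fun z => ‖z - u t‖ * Real.exp (2 * (2 / (y * y) * t)))
          (𝓝[≠] (u t)) (𝓝 0) := by
        have : Continuous fun z : ℂ => ‖z - u t‖ * Real.exp (2 * (2 / (y * y) * t)) := by fun_prop
        simpa using (this.tendsto (u t)).mono_left nhdsWithin_le_nhds
      refine squeeze_zero' (Eventually.of_forall fun _ => norm_nonneg _) ?_ hz0
      filter_upwards [hev] with z hz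
      obtain ⟨h1, h2⟩ := hU z (hy.trans hz)
      have := h1.norm_sub_le ht hl h hy (by rw [h2]; exact hz.le) hyu hs'
      rwa [h2] at this
    exact tendsto_const_nhds.div ((hlim.sub_const _).mul_const _)
      (mul_ne_zero (h.sub_ne_zero hs') (h.sub_ne_zero hs'))

/-! ### Hyperbolic distance and distortion -/

/-- The Poisson kernel `-im (1 / (z - x))` of the upper half-plane. -/
noncomputable def poisson (x : ℝ) (z : ℂ) : ℝ := z.im / ((z.re - x) ^ 2 + z.im ^ 2)

/-- `sinh (d / 2) ^ 2`, where `d` is the hyperbolic distance in the upper half-plane. -/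
noncomputable def sinhSq (z w : ℂ) : ℝ :=
  ((z.re - w.re) ^ 2 + (z.im - w.im) ^ 2) / (4 * z.im * w.im)

lemma sinhSq_comm (z w : ℂ) : sinhSq z w = sinhSq w z := by
  unfold sinhSq
  ring

lemma sinhSq_pos {z w : ℂ} (hz : 0 < z.im) (hw : 0 < w.im) (hne : z ≠ w) : 0 < sinhSq z w := by
  unfold sinhSq
  refine div_pos ?_ (by positivity)
  by_contra hle
  refine hne (Complex.ext ?_ ?_)
  · nlinarith [sq_nonneg (z.re - w.re), sq_nonneg (z.im - w.im)]
  · nlinarith [sq_nonneg (z.re - w.re), sq_nonneg (z.im - w.im)]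

lemma im_le_mul_im {z w : ℂ} (hz : 0 < z.im) (hw : 0 < w.im) :
    z.im ≤ 4 * (1 + sinhSq z w) * w.im := by
  have h : sinhSq z w * (4 * z.im * w.im) = (z.re - w.re) ^ 2 + (z.im - w.im) ^ 2 :=
    div_mul_cancel₀ _ (by positivity)
  have h1 : z.im * z.im ≤ z.im * (4 * (1 + sinhSq z w) * w.im) := by
    nlinarith [sq_nonneg (z.re - w.re), sq_nonneg w.im, mul_pos hz hw]
  exact le_of_mul_le_mul_left h1 hz

lemma exp_four_mul_arsinh_sqrt_le {x : ℝ} (hx : 0 ≤ x) :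
    Real.exp (4 * Real.arsinh (√x)) ≤ 16 * (1 + x) ^ 2 := by
  have h1 : Real.exp (4 * Real.arsinh (√x)) = (√x + √(1 + x)) ^ 4 := by
    rw [show (4 : ℝ) * Real.arsinh (√x) = (4 : ℕ) * Real.arsinh (√x) by norm_num, Real.exp_nat_mul,
      Real.exp_arsinh, Real.sq_sqrt hx]
  have h2 : √x ≤ √(1 + x) := Real.sqrt_le_sqrt (by linarith)
  have h3 : √(1 + x) ^ 2 = 1 + x := Real.sq_sqrt (by linarith)
  calc Real.exp (4 * Real.arsinh (√x)) = (√x + √(1 + x)) ^ 4 := h1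
    _ ≤ (√(1 + x) + √(1 + x)) ^ 4 := by gcongr
    _ = 16 * (√(1 + x) ^ 2) ^ 2 := by ring
    _ = 16 * (1 + x) ^ 2 := by rw [h3]

/-- A form of Harnack's inequality: `|P - R| ≤ tanh(d/2) (P + R)`. -/
lemma poisson_sub_sq_mul_le (x : ℝ) {z w : ℂ} (hz : 0 < z.im) (hw : 0 < w.im) :
    (poisson x z - poisson x w) ^ 2 * (1 + sinhSq z w) ≤
      sinhSq z w * (poisson x z + poisson x w) ^ 2 := by
  have hr : 0 < (z.re - x) ^ 2 + z.im ^ 2 := by positivity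
  have hs : 0 < (w.re - x) ^ 2 + w.im ^ 2 := by positivity
  -- The map `z ↦ -1/(z - x)` is a hyperbolic isometry and `poisson x z` is the imaginary part of
  -- the image; this is the invariance of `sinhSq`.
  have key : 4 * poisson x z * poisson x w * sinhSq z w =
      ((z.re - x) / ((z.re - x) ^ 2 + z.im ^ 2) - (w.re - x) / ((w.re - x) ^ 2 + w.im ^ 2)) ^ 2 +
        (poisson x z - poisson x w) ^ 2 := by
    unfold poisson sinhSq
    field_simp
    ring
  nlinarith [sq_nonneg ((z.re - x) / ((z.re - x) ^ 2 + z.im ^ 2) -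
    (w.re - x) / ((w.re - x) ^ 2 + w.im ^ 2))]

namespace IsTrajectory

lemma continuousOn_poisson_sq (hl : ContinuousOn lam (Icc 0 t)) (h : IsTrajectory lam t w u) :
    ContinuousOn (fun s => poisson (lam s) (u s) ^ 2) (Icc 0 t) := by
  have hre := Complex.continuous_re.comp_continuousOn h.continuousOn
  have him := Complex.continuous_im.comp_continuousOn h.continuousOn
  refine (him.div (((hre.sub hl).pow 2).add (him.pow 2)) fun s hs => ?_).pow 2
  have : 0 < (u s).im := (h.2 s hs).1
  exact (by positivity : ((u s).re - lam s) ^ 2 + (u s).im ^ 2 ≠ 0)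

/-- The modulus of the derivative of the inverse Loewner map. -/
lemma norm_exp_integral (ht : 0 ≤ t) (hl : ContinuousOn lam (Icc 0 t))
    (h : IsTrajectory lam t w u) :
    ‖Complex.exp (∫ s in (0 : ℝ)..t, 2 / ((u s - (lam s : ℂ)) * (u s - lam s)))‖ =
      (u 0).im / (u t).im * Real.exp (-(4 * ∫ s in (0 : ℝ)..t, poisson (lam s) (u s) ^ 2)) := by
  -- Conserved quantity: `Re 2/(u - λ)² + (log Im u)' = -4P²`.
  have hder : ∀ s ∈ Icc 0 t, HasDerivWithinAt
      (fun s => (∫ x in (0 : ℝ)..s, 2 / ((u x - (lam x : ℂ)) * (u x - lam x))).re +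
        Real.log (u s).im + 4 * ∫ x in (0 : ℝ)..s, poisson (lam x) (u x) ^ 2) 0 (Icc 0 t) s := by
    intro s hs
    have hpos := (h.2 s hs).1
    have h1 := Complex.reCLM.hasFDerivAt.comp_hasDerivWithinAt s
      (hasDerivWithinAt_integral_Icc (h.continuousOn_mul hl h) hs)
    have h2 := (h.hasDerivWithinAt_im hs).log hpos.ne'
    have h3 := (hasDerivWithinAt_integral_Icc (h.continuousOn_poisson_sq hl) hs).const_mul 4
    refine ((h1.add h2).add h3).congr_deriv ?_
    simp only [Complex.reCLM_apply, Complex.div_re, Complex.normSq_apply, Complex.mul_re,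
      Complex.mul_im, Complex.sub_re, Complex.sub_im, Complex.ofReal_re, Complex.ofReal_im,
      Complex.re_ofNat, Complex.im_ofNat, poisson, sub_zero, zero_mul, zero_div, add_zero]
    have hr : 0 < ((u s).re - lam s) ^ 2 + (u s).im ^ 2 := by positivity
    have hq : (((u s).re - lam s) * ((u s).re - lam s) - (u s).im * (u s).im) *
        (((u s).re - lam s) * ((u s).re - lam s) - (u s).im * (u s).im) +
        (((u s).re - lam s) * (u s).im + (u s).im * ((u s).re - lam s)) *
        (((u s).re - lam s) * (u s).im + (u s).im * ((u s).re - lam s)) =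
        (((u s).re - lam s) ^ 2 + (u s).im ^ 2) ^ 2 := by ring
    rw [hq]
    field_simp
    ring
  have hconst := constant_of_has_deriv_right_zero
    (fun r hr => (hder r hr).continuousWithinAt)
    (fun r hr => (hder r ⟨hr.1, hr.2.le⟩).mono_of_mem_nhdsWithin
      (Icc_mem_nhdsGE_of_mem ⟨hr.1, hr.2⟩)) t ⟨ht, le_rfl⟩
  simp only [intervalIntegral.integral_same, Complex.zero_re, zero_add, mul_zero, add_zero]
    at hconst
  have h0 := (h.2 0 ⟨le_rfl, ht⟩).1
  have h1 := (h.2 t ⟨ht, le_rfl⟩).1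
  rw [Complex.norm_exp, ← Real.exp_log (div_pos h0 h1), ← Real.exp_add,
    Real.log_div h0.ne' h1.ne', ← hconst]
  congr 1
  ring

lemma hasDerivWithinAt_sinhSq (h : IsTrajectory lam t w u) (h' : IsTrajectory lam t w' v) {s : ℝ}
    (hs : s ∈ Icc 0 t) :
    HasDerivWithinAt (fun s => sinhSq (u s) (v s))
      (2 * sinhSq (u s) (v s) *
        ((((u s).re - lam s) / (((u s).re - lam s) ^ 2 + (u s).im ^ 2) -
          ((v s).re - lam s) / (((v s).re - lam s) ^ 2 + (v s).im ^ 2)) ^ 2 +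
          (poisson (lam s) (u s) + poisson (lam s) (v s)) ^ 2)) (Icc 0 t) s := by
  have hu := (h.2 s hs).1
  have hv := (h'.2 s hs).1
  have h1 := ((((h.hasDerivWithinAt_re hs).sub (h'.hasDerivWithinAt_re hs)).pow 2).add
    (((h.hasDerivWithinAt_im hs).sub (h'.hasDerivWithinAt_im hs)).pow 2)).div
    (((h.hasDerivWithinAt_im hs).const_mul 4).mul (h'.hasDerivWithinAt_im hs))
    (by positivity : 4 * (u s).im * (v s).im ≠ 0)
  refine h1.congr_deriv ?_
  have hr : 0 < ((u s).re - lam s) ^ 2 + (u s).im ^ 2 := by positivity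
  have hq : 0 < ((v s).re - lam s) ^ 2 + (v s).im ^ 2 := by positivity
  simp only [poisson, sinhSq, Pi.add_apply, Pi.sub_apply, Pi.mul_apply, Pi.pow_apply]
  generalize (u s).im = a at *
  generalize (v s).im = b at *
  obtain ⟨x, hx⟩ : ∃ x, (u s).re = x + lam s := ⟨(u s).re - lam s, by ring⟩
  obtain ⟨y, hy⟩ : ∃ y, (v s).re = y + lam s := ⟨(v s).re - lam s, by ring⟩
  rw [hx, hy] at *
  simp only [add_sub_cancel_right, add_sub_add_right_eq_sub] at *
  field_simp
  ring

lemma ne_of_end_ne (ht : 0 ≤ t) (hl : ContinuousOn lam (Icc 0 t)) (h : IsTrajectory lam t w u)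
    (h' : IsTrajectory lam t w' v) (hne : u t ≠ v t) {s : ℝ} (hs : s ∈ Icc 0 t) : u s ≠ v s := by
  intro h0
  have h1 := h.sub_eq hl h' hs
  rw [h0, sub_self, eq_comm, mul_eq_zero, or_iff_left (Complex.exp_ne_zero _)] at h1
  have h2 := h.sub_eq hl h' ⟨ht, le_rfl⟩
  rw [h1, zero_mul] at h2
  exact hne (_root_.sub_eq_zero.1 h2)

lemma monotoneOn_sinhSq (h : IsTrajectory lam t w u) (h' : IsTrajectory lam t w' v) :
    MonotoneOn (fun s => sinhSq (u s) (v s)) (Icc 0 t) := by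
  refine monotoneOn_of_hasDerivWithinAt_nonneg (convex_Icc 0 t)
    (fun s hs => (h.hasDerivWithinAt_sinhSq h' hs).continuousWithinAt)
    (fun s hs => (h.hasDerivWithinAt_sinhSq h' (interior_subset hs)).mono interior_subset) ?_
  intro s hs
  have hu := (h.2 s (interior_subset hs)).1
  have hv := (h'.2 s (interior_subset hs)).1
  have : 0 ≤ sinhSq (u s) (v s) := by unfold sinhSq; positivity
  positivity

/-- Here `arsinh √sinhSq = d/2`, whose time derivative is at least `tanh(d/2) (P + R)²`. By Harnack
this dominates `(P - R)(P + R) = P² - R²`. Distinct end points keep `d > 0`, where the square root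
is differentiable. -/
lemma integral_poisson_sub_le (ht : 0 ≤ t) (hl : ContinuousOn lam (Icc 0 t))
    (h : IsTrajectory lam t w u) (h' : IsTrajectory lam t w' v) (hne : u t ≠ v t) :
    (∫ s in (0 : ℝ)..t, poisson (lam s) (u s) ^ 2) - ∫ s in (0 : ℝ)..t, poisson (lam s) (v s) ^ 2 ≤
      Real.arsinh (√(sinhSq (u t) (v t))) := by
  have hD : ∀ s ∈ Icc 0 t, 0 < sinhSq (u s) (v s) := fun s hs =>
    sinhSq_pos (h.2 s hs).1 (h'.2 s hs).1 (h.ne_of_end_ne ht hl h' hne hs)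
  have hder := fun s (hs : s ∈ Icc 0 t) =>
    (((h.hasDerivWithinAt_sinhSq h' hs).sqrt (hD s hs).ne').arsinh.sub
      (hasDerivWithinAt_integral_Icc (h.continuousOn_poisson_sq hl) hs)).add
      (hasDerivWithinAt_integral_Icc (h'.continuousOn_poisson_sq hl) hs)
  have hmono := monotoneOn_of_hasDerivWithinAt_nonneg (convex_Icc 0 t)
    (fun s hs => (hder s hs).continuousWithinAt)
    (fun s hs => (hder s (interior_subset hs)).mono interior_subset) (by
      intro s hs
      have hs' := interior_subset hs
      have hd := hD s hs'
      have hpl := poisson_sub_sq_mul_le (lam s) (h.2 s hs').1 (h'.2 s hs').1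
      have hu := (h.2 s hs').1
      have hv := (h'.2 s hs').1
      have hp : 0 ≤ poisson (lam s) (u s) := by unfold poisson; positivity
      have hq : 0 ≤ poisson (lam s) (v s) := by unfold poisson; positivity
      set d := sinhSq (u s) (v s)
      set P := poisson (lam s) (u s)
      set R := poisson (lam s) (v s)
      set A := ((u s).re - lam s) / (((u s).re - lam s) ^ 2 + (u s).im ^ 2) -
          ((v s).re - lam s) / (((v s).re - lam s) ^ 2 + (v s).im ^ 2)
      have hsd : √d ^ 2 = d := Real.sq_sqrt hd.le
      have hsd1 : √(1 + d) ^ 2 = 1 + d := Real.sq_sqrt (by linarith)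
      have hsp : 0 < √d := Real.sqrt_pos.2 hd
      have hsp1 : 0 < √(1 + d) := Real.sqrt_pos.2 (by linarith)
      have h1 : (P - R) * √(1 + d) ≤ √d * (P + R) := by
        refine abs_le_of_sq_le_sq' ?_ (by positivity) |>.2
        rw [mul_pow, mul_pow, hsd, hsd1]
        exact hpl
      have h2 : (P - R) * (P + R) ≤ (√(1 + d))⁻¹ * (√d * (P + R) ^ 2) := by
        rw [le_inv_mul_iff₀ hsp1]
        nlinarith
      have h3 : (√(1 + √d ^ 2))⁻¹ • (2 * d * (A ^ 2 + (P + R) ^ 2) / (2 * √d)) =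
          (√(1 + d))⁻¹ * (√d * (A ^ 2 + (P + R) ^ 2)) := by
        rw [hsd, smul_eq_mul]
        congr 1
        rw [div_eq_iff (by positivity)]
        linear_combination (-2 * (A ^ 2 + (P + R) ^ 2)) * hsd
      rw [h3]
      have h4 : (√(1 + d))⁻¹ * (√d * (P + R) ^ 2) ≤
          (√(1 + d))⁻¹ * (√d * (A ^ 2 + (P + R) ^ 2)) := by
        gcongr
        linarith [sq_nonneg A]
      linarith)
  have := hmono ⟨le_rfl, ht⟩ ⟨ht, le_rfl⟩ ht
  simp only [Pi.add_apply, Pi.sub_apply, intervalIntegral.integral_same, sub_zero, add_zero] at this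
  have h0 : 0 ≤ Real.arsinh (√(sinhSq (u 0) (v 0))) := Real.arsinh_nonneg_iff.2 (Real.sqrt_nonneg _)
  linarith

/-- Distortion estimate for the inverse Loewner maps. -/
lemma norm_exp_integral_le (ht : 0 ≤ t) (hl : ContinuousOn lam (Icc 0 t))
    (h : IsTrajectory lam t w u) (h' : IsTrajectory lam t w' v) :
    ‖Complex.exp (∫ s in (0 : ℝ)..t, 2 / ((u s - (lam s : ℂ)) * (u s - lam s)))‖ ≤
      64 * (1 + sinhSq (u t) (v t)) ^ 3 * ((v t).im / (u t).im) *
      ‖Complex.exp (∫ s in (0 : ℝ)..t, 2 / ((v s - (lam s : ℂ)) * (v s - lam s)))‖ := by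
  have hu0 := (h.2 0 ⟨le_rfl, ht⟩).1
  have hut := (h.2 t ⟨ht, le_rfl⟩).1
  have hv0 := (h'.2 0 ⟨le_rfl, ht⟩).1
  have hvt := (h'.2 t ⟨ht, le_rfl⟩).1
  have hD : 0 ≤ sinhSq (u t) (v t) := by unfold sinhSq; positivity
  -- The distance at time `0` is at most that at time `t`. This gives `4(1 + D)`, and the
  -- exponential below gives `16(1 + D)²`, whence `64(1 + D)³`.
  have him : (u 0).im ≤ 4 * (1 + sinhSq (u t) (v t)) * (v 0).im := by
    refine (im_le_mul_im hu0 hv0).trans ?_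
    gcongr
    exact h.monotoneOn_sinhSq h' ⟨le_rfl, ht⟩ ⟨ht, le_rfl⟩ ht
  have hexp : Real.exp (-(4 * ∫ s in (0 : ℝ)..t, poisson (lam s) (u s) ^ 2)) ≤
      16 * (1 + sinhSq (u t) (v t)) ^ 2 *
        Real.exp (-(4 * ∫ s in (0 : ℝ)..t, poisson (lam s) (v s) ^ 2)) := by
    have hle : (∫ s in (0 : ℝ)..t, poisson (lam s) (v s) ^ 2) -
        ∫ s in (0 : ℝ)..t, poisson (lam s) (u s) ^ 2 ≤ Real.arsinh (√(sinhSq (u t) (v t))) := by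
      by_cases hne : v t = u t
      · have heq : v 0 = u 0 := by
          have h1 := h'.initial_sub_eq ht hl h
          rw [hne, sub_self, zero_mul] at h1
          rw [h.1, h'.1]
          exact _root_.sub_eq_zero.1 h1
        have hw : w' = w := by rw [← h.1, ← h'.1, heq]
        subst hw
        have : ∫ s in (0 : ℝ)..t, poisson (lam s) (v s) ^ 2 =
            ∫ s in (0 : ℝ)..t, poisson (lam s) (u s) ^ 2 := by
          refine intervalIntegral.integral_congr fun s hs => ?_
          rw [uIcc_of_le ht] at hs
          simp only [h'.eqOn hl h hs]
        rw [this, sub_self]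
        exact Real.arsinh_nonneg_iff.2 (Real.sqrt_nonneg _)
      · rw [sinhSq_comm]
        exact h'.integral_poisson_sub_le ht hl h hne
    refine le_trans ?_ (mul_le_mul_of_nonneg_right (exp_four_mul_arsinh_sqrt_le hD)
      (Real.exp_pos _).le)
    rw [← Real.exp_add]
    gcongr
    linarith
  rw [h.norm_exp_integral ht hl, h'.norm_exp_integral ht hl]
  calc _ ≤ 4 * (1 + sinhSq (u t) (v t)) * (v 0).im / (u t).im * (16 * (1 + sinhSq (u t) (v t)) ^ 2 *
        Real.exp (-(4 * ∫ s in (0 : ℝ)..t, poisson (lam s) (v s) ^ 2))) := by gcongr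
    _ = _ := by
      field_simp
      ring

/-! ### Comparison of nearby times -/

lemma hasDerivAt_fHat (ht : 0 ≤ t) (hl : ContinuousOn lam (Icc 0 t)) (h : IsTrajectory lam t w u)
    {z : ℂ} (hz : u t = lam t + z) :
    HasDerivAt (fHat lam t)
      (Complex.exp (∫ s in (0 : ℝ)..t, 2 / ((u s - (lam s : ℂ)) * (u s - lam s)))) z := by
  have h1 := h.hasDerivAt_f ht hl
  rw [hz] at h1
  exact h1.comp_const_add (lam t : ℂ) z

lemma norm_exp_integral_restrict_le {s : ℝ} (hl : ContinuousOn lam (Icc 0 s))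
    (h : IsTrajectory lam s w u) (ht : 0 ≤ t) (hts : t ≤ s) :
    ‖Complex.exp (∫ x in (0 : ℝ)..t, 2 / ((u x - (lam x : ℂ)) * (u x - lam x)))‖ ≤
      Real.exp (2 / ((u s).im * (u s).im) * (s - t)) *
      ‖Complex.exp (∫ x in (0 : ℝ)..s, 2 / ((u x - (lam x : ℂ)) * (u x - lam x)))‖ := by
  have hpos := (h.2 s ⟨ht.trans hts, le_rfl⟩).1
  have hc := h.continuousOn_mul hl h
  have hadd := intervalIntegral.integral_add_adjacent_intervals (μ := MeasureTheory.volume)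
    (hc.mono (by rw [uIcc_of_le ht]; exact Icc_subset_Icc_right hts)).intervalIntegrable
    (hc.mono (by rw [uIcc_of_le hts]; exact Icc_subset_Icc_left ht)).intervalIntegrable
  have hle := intervalIntegral.norm_integral_le_of_norm_le_const (a := t) (b := s)
    (f := fun x => 2 / ((u x - (lam x : ℂ)) * (u x - lam x)))
    (C := 2 / ((u s).im * (u s).im)) (fun x hx => by
      rw [uIoc_of_le hts] at hx
      exact h.norm_integrand_le h hpos le_rfl le_rfl ⟨ht.trans hx.1.le, hx.2⟩)
  rw [abs_of_nonneg (sub_nonneg.2 hts)] at hle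
  rw [← hadd, Complex.norm_exp, Complex.norm_exp, ← Real.exp_add, Complex.add_re]
  gcongr
  have := (abs_le.1 (Complex.abs_re_le_norm (∫ x in t..s, 2 / ((u x - (lam x : ℂ)) *
    (u x - lam x))))).1
  linarith

lemma norm_sub_le_mul {s : ℝ} (h : IsTrajectory lam s w u) (ht : 0 ≤ t) (hts : t ≤ s) :
    ‖u s - u t‖ ≤ 2 / (u s).im * (s - t) := by
  have hpos := (h.2 s ⟨ht.trans hts, le_rfl⟩).1
  refine norm_image_sub_le_of_norm_deriv_le_segment'
    (fun x hx => (h.2 x ⟨ht.trans hx.1, hx.2⟩).2.mono (Icc_subset_Icc_left ht))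
    (fun x hx => ?_) s ⟨hts, le_rfl⟩
  rw [norm_div, Complex.norm_two]
  gcongr
  exact h.im_le_norm_sub ⟨ht.trans hx.1, hx.2.le⟩

end IsTrajectory

lemma abs_sub_le_p_mul (hl : ContinuousOn lam (Ici 0)) (ht : 0 ≤ t) {y : ℝ} (hy : 0 < y) {s : ℝ}
    (hts : t ≤ s) (hs : s - t ≤ y ^ 2) : |lam s - lam t| ≤ p lam t y * y := by
  have hc : ContinuousOn (fun r : ℝ => |lam (t + r) - lam t|) (Icc 0 (y ^ 2)) := by
    refine ((hl.comp (by fun_prop) fun r hr => ?_).sub continuousOn_const).abs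
    exact add_nonneg ht hr.1
  have hle := le_csSup (isCompact_Icc.image_of_continuousOn hc).bddAbove
    (mem_image_of_mem _ (⟨sub_nonneg.2 hts, hs⟩ : s - t ∈ Icc 0 (y ^ 2)))
  simp only [add_sub_cancel] at hle
  rw [p, one_div, mul_comm, mul_inv_cancel_left₀ hy.ne']
  exact hle

/-- Comparison of the derivatives of the inverse maps at two times `t ≤ s` with `s - t` at most of
the order of the square of the height. -/
lemma norm_deriv_fHat_le (hl : ContinuousOn lam (Ici 0)) (ht : 0 ≤ t) {s y η : ℝ} (hts : t ≤ s)
    (hη : 0 < η) (hs : s - t ≤ η ^ 2) (hηy : η ≤ y) (hy : y ≤ 2 * η) :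
    DifferentiableAt ℂ (fHat lam t) (Complex.I * (y : ℂ)) ∧
    ‖deriv (fHat lam t) (Complex.I * (y : ℂ))‖ ≤
      1536000 * (1 + p lam t y ^ 2) ^ 3 * ‖deriv (fHat lam s) (Complex.I * (η : ℂ))‖ := by
  have hy0 : 0 < y := hη.trans_le hηy
  have hls : ContinuousOn lam (Icc 0 s) := hl.mono Icc_subset_Ici_self
  have hlt : ContinuousOn lam (Icc 0 t) := hl.mono Icc_subset_Ici_self
  have hs0 : 0 ≤ s := ht.trans hts
  obtain ⟨w, u, hu, hus⟩ := exists_isTrajectory hs0 hls (z := lam s + Complex.I * η) (by simpa)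
  obtain ⟨w', v, hv, hvt⟩ := exists_isTrajectory ht hlt (z := lam t + Complex.I * y) (by simpa)
  have hds := hu.hasDerivAt_fHat hs0 hls hus
  have hdt := hv.hasDerivAt_fHat ht hlt hvt
  refine ⟨hdt.differentiableAt, ?_⟩
  rw [hds.deriv, hdt.deriv]
  have husim : (u s).im = η := by simp [hus]
  have husre : (u s).re = lam s := by simp [hus]
  have hvtim : (v t).im = y := by simp [hvt]
  have hvtre : (v t).re = lam t := by simp [hvt]
  have hdist := hv.norm_exp_integral_le ht hlt (hu.restrict hts)
  have htime := hu.norm_exp_integral_restrict_le hls ht hts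
  have hmove := hu.norm_sub_le_mul ht hts
  have hlam := abs_sub_le_p_mul hl ht hy0 hts (hs.trans (by gcongr))
  have him : η ≤ (u t).im := by
    rw [← husim]
    exact hu.antitoneOn_im ⟨ht, hts⟩ ⟨hs0, le_rfl⟩ hts
  have hp : 0 ≤ p lam t y := nonneg_of_mul_nonneg_left ((abs_nonneg _).trans hlam) hy0
  rw [husim] at hmove htime
  have hmove' : ‖u s - u t‖ ≤ 2 * η := by
    refine hmove.trans ?_
    rw [div_mul_eq_mul_div, div_le_iff₀ hη]
    nlinarith
  have hre : |(u s - u t).re| ≤ 2 * η := (Complex.abs_re_le_norm _).trans hmove'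
  have himm : |(u s - u t).im| ≤ 2 * η := (Complex.abs_im_le_norm _).trans hmove'
  rw [Complex.sub_re, husre, abs_le] at hre
  rw [Complex.sub_im, husim, abs_le] at himm
  rw [abs_le] at hlam
  -- The bound is `e² < 8`.
  have hexp : Real.exp (2 / (η * η) * (s - t)) ≤ 8 := by
    have h1 : 2 / (η * η) * (s - t) ≤ 2 := by
      rw [div_mul_eq_mul_div, div_le_iff₀ (by positivity)]
      nlinarith
    have h2 : Real.exp 2 = Real.exp 1 ^ 2 := by
      rw [← Real.exp_nat_mul]
      norm_num
    have h3 := Real.exp_one_lt_d9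
    have h4 := Real.exp_pos 1
    refine (Real.exp_le_exp.2 h1).trans ?_
    rw [h2]
    nlinarith
  set q := p lam t y
  -- The horizontal gap is at most `|λ(s) - λ(t)| + 2η ≤ (q + 2)y`, the vertical one at most `2y`,
  -- and `Im u t ≥ η ≥ y/2`.
  have hD : 1 + sinhSq (v t) (u t) ≤ 10 * (1 + q ^ 2) := by
    unfold sinhSq
    rw [hvtim, hvtre]
    have h1 : (lam t - (u t).re) ^ 2 ≤ ((2 + q) * y) ^ 2 := by
      rw [sq_le_sq, abs_of_nonneg (by positivity : 0 ≤ (2 + q) * y), abs_le]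
      constructor <;> nlinarith
    have h2 : (y - (u t).im) ^ 2 ≤ (2 * y) ^ 2 := by
      rw [sq_le_sq, abs_of_nonneg (by positivity : 0 ≤ 2 * y), abs_le]
      constructor <;> linarith
    have h3 : ((lam t - (u t).re) ^ 2 + (y - (u t).im) ^ 2) / (4 * y * (u t).im) ≤
        (((2 + q) * y) ^ 2 + (2 * y) ^ 2) / (4 * y * (y / 2)) := by
      gcongr
      linarith
    have h4 : (((2 + q) * y) ^ 2 + (2 * y) ^ 2) / (4 * y * (y / 2)) = ((2 + q) ^ 2 + 4) / 2 := by
      field_simp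
      ring
    nlinarith [sq_nonneg (q - 1)]
  have hD0 : 0 ≤ 1 + sinhSq (v t) (u t) := by
    unfold sinhSq
    rw [hvtim]
    have := hη.trans_le him
    positivity
  have hratio : (u t).im / (v t).im ≤ 3 := by
    rw [hvtim, div_le_iff₀ hy0]
    linarith
  have hratio0 : 0 ≤ (u t).im / (v t).im := by
    rw [hvtim]
    have := hη.trans_le him
    positivity
  calc _ ≤ _ := hdist
    _ ≤ 64 * (10 * (1 + q ^ 2)) ^ 3 * 3 * (8 * ‖Complex.exp
        (∫ x in (0 : ℝ)..s, 2 / ((u x - (lam x : ℂ)) * (u x - lam x)))‖) := by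
      gcongr
      refine htime.trans ?_
      gcongr
    _ = _ := by ring

end Loewner

/-! ### Reduction to dyadic times and heights -/

theorem mainTheorem3 :
    ∃ c₁ c₂ : ℝ, 0 < c₁ ∧ 0 < c₂ ∧
      ∀ lam : ℝ → ℝ, ContinuousOn lam (Set.Ici 0) →
      ∀ β : ℝ, 0 < β → β < 1 →
      ∀ n : ℕ,
        (∀ m : ℕ, n ≤ m → ∀ j : ℕ, 1 ≤ j → j ≤ 2 ^ (2 * m) →
          ‖deriv (Loewner.fHat lam ((j : ℝ) / 2 ^ (2 * m)))
              (Complex.I * (((1 / 2 ^ m : ℝ)) : ℂ))‖ ≤ (2 : ℝ) ^ (β * (m : ℝ))) →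
        ∀ t y : ℝ, 0 ≤ t → t ≤ 1 → 0 < y → y ≤ 1 / 2 ^ n →
          DifferentiableAt ℂ (Loewner.fHat lam t) (Complex.I * (y : ℂ)) ∧
          ‖deriv (Loewner.fHat lam t) (Complex.I * (y : ℂ))‖ ≤
            Loewner.Q c₁ c₂ (Loewner.p lam t y) * y ^ (-β) := by
  -- Twice the constant of `norm_deriv_fHat_le`; the extra `2` bounds `2^β` in `hpow`.
  refine ⟨3072000, 3, by norm_num, by norm_num, ?_⟩
  intro lam hl β hβ0 hβ1 n hyp t y ht0 ht1 hy0 hyn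
  obtain ⟨m, hm1, hm2⟩ : ∃ m : ℕ, 1 / 2 ^ m ≤ y ∧ y ≤ 2 * (1 / 2 ^ m) := by
    obtain ⟨k, hk1, hk2⟩ := exists_nat_pow_near_of_lt_one hy0
      (hyn.trans (by
        rw [div_le_one (by positivity)]
        exact one_le_pow₀ one_le_two)) (by norm_num : (0 : ℝ) < 1 / 2) (by norm_num)
    rw [one_div_pow] at hk1 hk2
    refine ⟨k + 1, hk1.le, hk2.trans_eq ?_⟩
    rw [pow_succ]
    field_simp
  have hnm : n ≤ m := by
    have h1 := hm1.trans hyn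
    rw [one_div_le_one_div (by positivity) (by positivity)] at h1
    exact (pow_le_pow_iff_right₀ one_lt_two).1 h1
  set N : ℝ := 2 ^ (2 * m) with hN
  have hN0 : 0 < N := by positivity
  obtain ⟨j, hj1, hj2, hj3, hj4⟩ : ∃ j : ℕ, 1 ≤ j ∧ j ≤ 2 ^ (2 * m) ∧ t ≤ j / N ∧
      j / N - t ≤ (1 / 2 ^ m) ^ 2 := by
    have hNm : (1 / 2 ^ m : ℝ) ^ 2 = 1 / N := by
      rw [hN, one_div_pow, ← pow_mul, mul_comm m 2]
    rcases ht0.eq_or_lt with rfl | hpos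
    -- At `t = 0` the ceiling would give `j = 0`, which the hypothesis excludes.
    · refine ⟨1, le_rfl, Nat.one_le_two_pow, by positivity, ?_⟩
      rw [hNm]
      simp
    · refine ⟨⌈t * N⌉₊, Nat.one_le_ceil_iff.2 (by positivity), ?_, ?_, ?_⟩
      · rw [Nat.ceil_le]
        push_cast
        rw [← hN]
        nlinarith
      · rw [le_div_iff₀ hN0]
        exact Nat.le_ceil _
      · rw [hNm, sub_le_iff_le_add, div_le_iff₀ hN0, add_mul, one_div_mul_cancel hN0.ne']
        linarith [(Nat.ceil_lt_add_one (by positivity : 0 ≤ t * N)).le]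
  obtain ⟨hdiff, hle⟩ := Loewner.norm_deriv_fHat_le hl ht0 (s := j / N) (y := y)
    (η := 1 / 2 ^ m) hj3 (by positivity) hj4 hm1 hm2
  refine ⟨hdiff, hle.trans ?_⟩
  have hpow : (2 : ℝ) ^ (β * (m : ℝ)) ≤ 2 * y ^ (-β) := by
    have h1 : ((2 : ℝ) ^ m) ≤ 2 / y := by
      rw [le_div_iff₀ hy0]
      rw [mul_one_div, le_div_iff₀ (by positivity)] at hm2
      linarith
    calc (2 : ℝ) ^ (β * (m : ℝ)) = ((2 : ℝ) ^ m) ^ β := by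
          rw [mul_comm, Real.rpow_mul zero_le_two, Real.rpow_natCast]
      _ ≤ (2 / y) ^ β := by gcongr
      _ = 2 ^ β * y ^ (-β) := by
          rw [Real.div_rpow zero_le_two hy0.le, Real.rpow_neg hy0.le, div_eq_mul_inv]
      _ ≤ 2 * y ^ (-β) := by
          gcongr
          simpa using Real.rpow_le_rpow_of_exponent_le one_le_two hβ1.le
  have hQ : Loewner.Q 3072000 3 (Loewner.p lam t y) =
      3072000 * (1 + Loewner.p lam t y ^ 2) ^ 3 := by
    rw [Loewner.Q]
    norm_cast
  rw [hQ]
  calc _ ≤ 1536000 * (1 + Loewner.p lam t y ^ 2) ^ 3 * (2 * y ^ (-β)) := by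
        gcongr
        exact (hyp m hnm j hj1 hj2).trans hpow
    _ = _ := by ring
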